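/- Let $p\ge 1$ and let $D=(d_{ij})_{i,j\ge 1}$ be a complex $p$-banded matrix, i.e. $d_{ij}=0$ for $|i-j|>p$ and $d_{ij}\ne 0$ for $|i-j|=p$, such that $\lim_{i\to\infty}d_{i,i\pm p}=1$ and $\lim_{i\to\infty}d_{i,i+r}=0$ for $|r|<p$. We regard $D$ as a bounded operator on $\ell^2(\mathbb N)$, $\mathbb N=\{1,2,\dots\}$. Its discrete spectrum $\sigma_{\rm d}(D)$ is the set of isolated points of its spectrum that are eigenvalues of finite algebraic multiplicity. Extend the entries to indices with $\min(i,j)\le 0$ by $d_{ij}=1$ if $|i-j|=p$ and $d_{ij}=0$ otherwise, and for $n\in\mathbb N$ put $$q_n=|d_{n,n-p}-1|+\sum_{r=-p+1}^{p-1}|d_{n,n+r}|+|d_{n,n+p}-1|,$$ $$q=\sup_{n\ge1}q_n,\qquad Q_0=\sum_{n=1}^\infty q_n,\qquad Q_1=\sum_{n=1}^\infty n\,q_n .$$ Let $t$ be the unique real root of $te^t=1$, and let $\mathbb D$ be the open unit disk. **Theorem.** Assume that $Q_0<\infty$ and $q<1$. Then the set $$G(D)=\Bigl\{z+z^{-1}:\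 z\in\mathbb D\setminus\{0\},\ |z-z^{-1}|>\frac{8Q_0}{t}\exp\Bigl\{\frac{2-q}{1-q}\,Q_0\Bigr\}\Bigr\}$$ does not meet the discrete spectrum $\sigma_{\rm d}(D)$. If moreover $Q_1<\infty$ and $$\exp\Bigl\{\frac{2-q}{1-q}\,Q_0\Bigr\}\,Q_1<\frac t4,$$ then $\sigma_{\rm d}(D)=\emptyset$. -/

import Mathlib

open Filter Topology

noncomputable section

/-- The entries `d_{ij}` of a semi-infinite matrix (rows and columns numbered `1, 2, 3, …`), extended
to all integers `i, j`: if `min (i, j) ≤ 0`, then `d_{ij} = 1` for `|i - j| = p` and `d_{ij} = 0`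
for `|i - j| ≠ p`. -/
def extEntry (p : ℕ) (d : ℕ+ → ℕ+ → ℂ) (i j : ℤ) : ℂ :=
  if h : 0 < i ∧ 0 < j then d ⟨i.toNat, by omega⟩ ⟨j.toNat, by omega⟩
  else if |i - j| = (p : ℤ) then 1 else 0

/-- A semi-infinite complex `p`-banded matrix, `d_{ij} = 0` for `|i - j| > p` and `d_{ij} ≠ 0` for
`|i - j| = p`, which is asymptotically the standard one: `d_{i, i ± p} → 1`, and `d_{i, i + r} → 0`
for `|r| < p`, as `i → ∞`. -/
structure BandedMatrix (p : ℕ) where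
  entry : ℕ+ → ℕ+ → ℂ
  eq_zero : ∀ i j : ℕ+, (p : ℤ) < |(i : ℤ) - (j : ℤ)| → entry i j = 0
  ne_zero : ∀ i j : ℕ+, |(i : ℤ) - (j : ℤ)| = (p : ℤ) → entry i j ≠ 0
  tendsto_lower : Tendsto (fun i : ℕ+ => extEntry p entry i ((i : ℤ) - p)) atTop (𝓝 1)
  tendsto_upper : Tendsto (fun i : ℕ+ => extEntry p entry i ((i : ℤ) + p)) atTop (𝓝 1)
  tendsto_inner : ∀ r : ℤ, |r| < (p : ℤ) →
    Tendsto (fun i : ℕ+ => extEntry p entry i ((i : ℤ) + r)) atTop (𝓝 0)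

/-- The complex Hilbert space `ℓ²(ℕ)`, `ℕ = {1, 2, 3, …}`. -/
abbrev EllTwo : Type := lp (fun _ : ℕ+ => ℂ) 2

theorem extEntry_coe (p : ℕ) (d : ℕ+ → ℕ+ → ℂ) (i j : ℕ+) :
    extEntry p d (i : ℤ) (j : ℤ) = d i j := by
  have h : 0 < ((i : ℕ) : ℤ) ∧ 0 < ((j : ℕ) : ℤ) :=
    ⟨by exact_mod_cast i.pos, by exact_mod_cast j.pos⟩
  unfold extEntry
  rw [dif_pos h]
  congr 1

namespace BandedMatrix

variable {p : ℕ} (D : BandedMatrix p)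

/-- `q_n = |d_{n, n-p} - 1| + ∑_{|r| < p} |d_{n, n+r}| + |d_{n, n+p} - 1|`. -/
def q (n : ℕ+) : ℝ :=
  ‖extEntry p D.entry n ((n : ℤ) - p) - 1‖
    + ∑ r ∈ Finset.Ioo (-(p : ℤ)) (p : ℤ), ‖extEntry p D.entry n ((n : ℤ) + r)‖
    + ‖extEntry p D.entry n ((n : ℤ) + p) - 1‖

/-- `q = sup_n q_n`. -/
def qSup : ℝ := ⨆ n : ℕ+, D.q n

/-- `Q_0 = ∑_n q_n`. -/
def Q₀ : ℝ := ∑' n : ℕ+, D.q n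

/-- `Q_1 = ∑_n n q_n`. -/
def Q₁ : ℝ := ∑' n : ℕ+, (n : ℝ) * D.q n

theorem exists_bound : ∃ C : ℝ, 0 ≤ C ∧ ∀ i j : ℕ+, ‖D.entry i j‖ ≤ C := by
  have key : ∀ (f : ℕ+ → ℂ) (a : ℂ), Tendsto f atTop (𝓝 a) → ∃ C : ℝ, ∀ i, ‖f i‖ ≤ C := by
    intro f a hf
    have h1 : Tendsto Nat.succPNat atTop atTop := by
      refine tendsto_atTop.2 fun b => ?_
      filter_upwards [eventually_ge_atTop (b : ℕ)] with n hn
      exact PNat.coe_le_coe _ _ |>.1 (by simpa using Nat.le_succ_of_le hn)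
    obtain ⟨C, hC⟩ := (Metric.isBounded_range_of_tendsto _ (hf.comp h1)).exists_norm_le
    refine ⟨C, fun i => hC _ ⟨i.natPred, ?_⟩⟩
    simp
  have diag : ∀ r : ℤ, |r| ≤ (p : ℤ) →
      ∃ C : ℝ, ∀ i : ℕ+, ‖extEntry p D.entry i ((i : ℤ) + r)‖ ≤ C := by
    intro r hr
    rcases lt_or_eq_of_le hr with h | h
    · exact key _ _ (D.tendsto_inner r h)
    · rcases eq_or_eq_neg_of_abs_eq h with h | h
      · subst h
        exact key _ _ D.tendsto_upper
      · subst h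
        exact key _ _ D.tendsto_lower
  choose! C hC using diag
  refine ⟨∑ r ∈ Finset.Icc (-(p : ℤ)) (p : ℤ), |C r|,
    Finset.sum_nonneg fun _ _ => abs_nonneg _, fun i j => ?_⟩
  by_cases hij : |(j : ℤ) - (i : ℤ)| ≤ (p : ℤ)
  · have h1 := hC _ hij i
    rw [add_sub_cancel, extEntry_coe] at h1
    refine h1.trans ((le_abs_self _).trans ?_)
    exact Finset.single_le_sum (f := fun r => |C r|) (fun _ _ => abs_nonneg _)
      (Finset.mem_Icc.2 (abs_le.1 hij))
  · rw [D.eq_zero i j (by rw [abs_sub_comm]; exact not_le.1 hij), norm_zero]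
    exact Finset.sum_nonneg fun _ _ => abs_nonneg _

/-- The finite set of all `m ≥ 1` with `|m - n| ≤ p`. -/
def band (p : ℕ) (n : ℕ+) : Finset ℕ+ :=
  (Finset.Icc 1 (n + p.succPNat)).filter fun m => |(m : ℤ) - (n : ℤ)| ≤ (p : ℤ)

theorem mem_band {n m : ℕ+} : m ∈ band p n ↔ |(m : ℤ) - (n : ℤ)| ≤ (p : ℤ) := by
  unfold band
  rw [Finset.mem_filter, Finset.mem_Icc, and_iff_right_iff_imp]
  refine fun h => ⟨one_le, ?_⟩
  rw [← PNat.coe_le_coe, PNat.add_coe, Nat.succPNat_coe]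
  have := (abs_le.1 h).2
  omega

theorem card_band_le (n : ℕ+) : (band p n).card ≤ 2 * p + 1 := by
  have h : (band p n).card ≤ (Finset.Icc (-(p : ℤ)) (p : ℤ)).card := by
    refine Finset.card_le_card_of_injOn (fun m : ℕ+ => (m : ℤ) - (n : ℤ)) ?_ ?_
    · intro m hm
      exact Finset.mem_coe.2 (Finset.mem_Icc.2 (abs_le.1 (mem_band.1 hm)))
    · intro a _ b _ hab
      have hab' : (a : ℤ) - (n : ℤ) = (b : ℤ) - (n : ℤ) := hab
      exact PNat.eq (by omega)
  rw [Int.card_Icc] at h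
  omega

/-- The product `D x` of the matrix and a sequence `x`: `(D x)_n = ∑_m d_{nm} x_m`, a finite sum
for every `n`. -/
def mulSeq (x : ℕ+ → ℂ) (n : ℕ+) : ℂ := ∑' m : ℕ+, D.entry n m * x m

theorem mulSeq_eq_sum (x : ℕ+ → ℂ) (n : ℕ+) :
    D.mulSeq x n = ∑ m ∈ band p n, D.entry n m * x m := by
  refine tsum_eq_sum fun m hm => ?_
  rw [mem_band, not_le, abs_sub_comm] at hm
  rw [D.eq_zero n m hm, zero_mul]

theorem sum_mulSeq_le {C : ℝ} (hC : ∀ i j : ℕ+, ‖D.entry i j‖ ≤ C) (x : EllTwo)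
    (s : Finset ℕ+) :
    ∑ n ∈ s, ‖D.mulSeq x n‖ ^ 2 ≤ ((2 * p + 1 : ℕ) * C * ‖x‖) ^ 2 := by
  have row : ∀ n, ‖D.mulSeq x n‖ ^ 2 ≤ (2 * p + 1 : ℕ) * C ^ 2 * ∑ m ∈ band p n, ‖x m‖ ^ 2 := by
    intro n
    have h1 : ‖D.mulSeq x n‖ ≤ C * ∑ m ∈ band p n, ‖x m‖ := by
      rw [mulSeq_eq_sum, Finset.mul_sum]
      refine norm_sum_le_of_le _ fun m _ => ?_
      rw [norm_mul]
      exact mul_le_mul_of_nonneg_right (hC n m) (norm_nonneg _)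
    have h2 := sq_sum_le_card_mul_sum_sq (s := band p n) (f := fun m => ‖x m‖)
    have h3 : ((band p n).card : ℝ) ≤ (2 * p + 1 : ℕ) := by exact_mod_cast card_band_le n
    have h4 : 0 ≤ ∑ m ∈ band p n, ‖x m‖ ^ 2 := Finset.sum_nonneg fun _ _ => sq_nonneg _
    calc ‖D.mulSeq x n‖ ^ 2 ≤ (C * ∑ m ∈ band p n, ‖x m‖) ^ 2 :=
          pow_le_pow_left₀ (norm_nonneg _) h1 2
      _ = C ^ 2 * (∑ m ∈ band p n, ‖x m‖) ^ 2 := by ring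
      _ ≤ C ^ 2 * ((2 * p + 1 : ℕ) * ∑ m ∈ band p n, ‖x m‖ ^ 2) :=
          mul_le_mul_of_nonneg_left (h2.trans (mul_le_mul_of_nonneg_right h3 h4)) (sq_nonneg _)
      _ = _ := by ring
  have swap : ∑ n ∈ s, ∑ m ∈ band p n, ‖x m‖ ^ 2 ≤ (2 * p + 1 : ℕ) * ‖x‖ ^ 2 := by
    have e : ∑ n ∈ s, ∑ m ∈ band p n, ‖x m‖ ^ 2
        = ∑ m ∈ s.biUnion (band p), ∑ n ∈ s.filter (fun n => m ∈ band p n), ‖x m‖ ^ 2 := by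
      refine Finset.sum_comm' fun n m => ?_
      simp only [Finset.mem_biUnion, Finset.mem_filter]
      exact ⟨fun h => ⟨h, n, h⟩, fun h => h.1⟩
    have hc : ∀ m, ((s.filter (fun n => m ∈ band p n)).card : ℝ) ≤ (2 * p + 1 : ℕ) := by
      intro m
      have hsub : s.filter (fun n => m ∈ band p n) ⊆ band p m := by
        intro n hn
        have := mem_band.1 (Finset.mem_filter.1 hn).2
        rw [abs_sub_comm] at this
        exact mem_band.2 this
      exact_mod_cast (Finset.card_le_card hsub).trans (card_band_le m)
    have hx : ∑ m ∈ s.biUnion (band p), ‖x m‖ ^ 2 ≤ ‖x‖ ^ 2 := by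
      have := lp.sum_rpow_le_norm_rpow (p := 2) (by norm_num) x (s.biUnion (band p))
      simpa using this
    rw [e]
    calc ∑ m ∈ s.biUnion (band p), ∑ n ∈ s.filter (fun n => m ∈ band p n), ‖x m‖ ^ 2
        ≤ ∑ m ∈ s.biUnion (band p), (2 * p + 1 : ℕ) * ‖x m‖ ^ 2 := by
          refine Finset.sum_le_sum fun m _ => ?_
          rw [Finset.sum_const, nsmul_eq_mul]
          exact mul_le_mul_of_nonneg_right (hc m) (sq_nonneg _)
      _ = (2 * p + 1 : ℕ) * ∑ m ∈ s.biUnion (band p), ‖x m‖ ^ 2 := by rw [Finset.mul_sum]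
      _ ≤ _ := mul_le_mul_of_nonneg_left hx (Nat.cast_nonneg _)
  calc ∑ n ∈ s, ‖D.mulSeq x n‖ ^ 2
      ≤ ∑ n ∈ s, (2 * p + 1 : ℕ) * C ^ 2 * ∑ m ∈ band p n, ‖x m‖ ^ 2 :=
        Finset.sum_le_sum fun n _ => row n
    _ = (2 * p + 1 : ℕ) * C ^ 2 * ∑ n ∈ s, ∑ m ∈ band p n, ‖x m‖ ^ 2 := by rw [Finset.mul_sum]
    _ ≤ (2 * p + 1 : ℕ) * C ^ 2 * ((2 * p + 1 : ℕ) * ‖x‖ ^ 2) :=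
        mul_le_mul_of_nonneg_left swap (by positivity)
    _ = _ := by ring

theorem memℓp_mulSeq (x : EllTwo) : Memℓp (D.mulSeq x) 2 := by
  obtain ⟨C, hC0, hC⟩ := D.exists_bound
  refine memℓp_gen' (C := ((2 * p + 1 : ℕ) * C * ‖x‖) ^ 2) fun s => ?_
  simpa using D.sum_mulSeq_le hC x s

/-- The linear map `x ↦ D x` of `ℓ²`. -/
def toLinearMap : EllTwo →ₗ[ℂ] EllTwo where
  toFun x := ⟨D.mulSeq x, D.memℓp_mulSeq x⟩
  map_add' x y := by
    refine lp.ext (funext fun n => ?_)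
    change D.mulSeq (x + y : EllTwo) n = D.mulSeq x n + D.mulSeq y n
    simp only [mulSeq_eq_sum, lp.coeFn_add, Pi.add_apply, mul_add, Finset.sum_add_distrib]
  map_smul' c x := by
    refine lp.ext (funext fun n => ?_)
    change D.mulSeq (c • x : EllTwo) n = c * D.mulSeq x n
    simp only [mulSeq_eq_sum, lp.coeFn_smul, Pi.smul_apply, smul_eq_mul, Finset.mul_sum]
    exact Finset.sum_congr rfl fun m _ => by ring

theorem exists_norm_toLinearMap_le : ∃ M : ℝ, ∀ x, ‖D.toLinearMap x‖ ≤ M * ‖x‖ := by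
  obtain ⟨C, hC0, hC⟩ := D.exists_bound
  refine ⟨(2 * p + 1 : ℕ) * C, fun x => ?_⟩
  refine lp.norm_le_of_forall_sum_le (p := 2) (by norm_num) (by positivity) fun s => ?_
  simpa [toLinearMap] using D.sum_mulSeq_le hC x s

/-- The bounded operator on `ℓ²` generated by the matrix. -/
def toOperator : EllTwo →L[ℂ] EllTwo :=
  D.toLinearMap.mkContinuousOfExistsBound D.exists_norm_toLinearMap_le

theorem toOperator_apply (x : EllTwo) (n : ℕ+) :
    D.toOperator x n = ∑' m : ℕ+, D.entry n m * x m := rfl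

end BandedMatrix

/-- The discrete spectrum of a bounded operator: the isolated points of the spectrum that are
eigenvalues of finite algebraic multiplicity, which is the dimension of the root subspace
`⋃ₖ ker (T - μ)ᵏ`. -/
def discreteSpectrum {E : Type*} [NormedAddCommGroup E] [NormedSpace ℂ E] (T : E →L[ℂ] E) :
    Set ℂ :=
  {μ | (∀ᶠ w in 𝓝[≠] μ, w ∉ spectrum ℂ T) ∧
    Module.End.HasEigenvalue (T : E →ₗ[ℂ] E) μ ∧
    FiniteDimensional ℂ (Module.End.maxGenEigenspace (T : E →ₗ[ℂ] E) μ)}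

end

/-!
No Jost solution is needed: the eigenvalue equation is inverted exactly and an eigenvector is
estimated in the supremum norm.

Let `D u = λ u` with `u ∈ ℓ²`, extend `u` by zero to the integers, and write `λ = z + z⁻¹` with
`0 < ‖z‖ ≤ 1`. Moving everything but the free part to the other side gives
`u_{n+p} + u_{n-p} - λ u_n = -(V u)_n` for `n ≥ 1`, where `‖(V u)_n‖ ≤ q_n ‖u‖_∞`
(`BandedMatrix.norm_secondDiff_le`). Along a residue class modulo `p` this is a second order
recurrence `a_{j+2} + a_j - λ a_{j+1} = f_j` for a sequence with `a_0 = 0` and `a_j → 0`.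
It factors into two first order recurrences, for `b_j = a_{j+1} - z a_j` and for
`c_j = a_{j+1} - z⁻¹ a_j`. The first is solved from infinity, the second from `0`, and both solutions
are stable because `‖z‖ ≤ 1`. Together they yield
`‖z - z⁻¹‖ ‖a_k‖ ≤ 2 ∑ ‖f_i‖` and `‖a_k‖ ≤ ∑ (i + 1) ‖f_i‖`.
Taking the supremum over all residue classes, `‖z - z⁻¹‖ ‖u‖_∞ ≤ 2 Q₀ ‖u‖_∞` and
`‖u‖_∞ ≤ Q₁ ‖u‖_∞`, so that an eigenvector forces `‖z - z⁻¹‖ ≤ 2 Q₀` and `1 ≤ Q₁`. Since `0 < t ≤ 1`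
and the exponential factors are at least `1`, this excludes eigenvalues in both situations; the second
estimate holds on the whole unit circle as well, hence there are no eigenvalues in `[-2, 2]` either.
-/

/-! ### The scalar recurrence `a_{j+2} + a_j - (z + z⁻¹) a_{j+1} = f_j` -/

open Finset in
/-- Solving the first order recurrence for `a_{j+1} - z a_j` backwards. -/
theorem norm_sub_mul_le_add_sum {a : ℕ → ℂ} {z : ℂ} (hz0 : z ≠ 0) (hz : ‖z‖ ≤ 1) {k N : ℕ}
    (hkN : k ≤ N) :
    ‖a (k + 1) - z * a k‖ ≤ ‖a (N + 1) - z * a N‖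
      + ∑ i ∈ Ico k N, ‖a (i + 2) + a i - (z + z⁻¹) * a (i + 1)‖ := by
  induction N, hkN using Nat.le_induction with
  | base => simp
  | succ N hkN ih =>
    rw [sum_Ico_succ_top hkN]
    have e : a (N + 1) - z * a N = z * ((a (N + 1 + 1) - z * a (N + 1))
        - (a (N + 2) + a N - (z + z⁻¹) * a (N + 1))) := by
      field_simp
      ring
    have h : ‖a (N + 1) - z * a N‖ ≤ ‖a (N + 1 + 1) - z * a (N + 1)‖
        + ‖a (N + 2) + a N - (z + z⁻¹) * a (N + 1)‖ := by
      rw [e, norm_mul]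
      exact (mul_le_of_le_one_left (norm_nonneg _) hz).trans (norm_sub_le _ _)
    linarith

open Finset in
/-- Solving the first order recurrence for `a_{j+1} - z⁻¹ a_j` forwards. -/
theorem norm_sub_inv_mul_le_add_sum {a : ℕ → ℂ} (ha0 : a 0 = 0) {z : ℂ} (hz0 : z ≠ 0)
    (hz : ‖z‖ ≤ 1) (k : ℕ) :
    ‖a (k + 1) - z⁻¹ * a k‖ ≤ ‖a 1‖
      + ∑ i ∈ range k, ‖a (i + 2) + a i - (z + z⁻¹) * a (i + 1)‖ := by
  induction k with
  | zero => simp [ha0]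
  | succ k ih =>
    rw [sum_range_succ]
    have e : a (k + 1 + 1) - z⁻¹ * a (k + 1) = z * (a (k + 1) - z⁻¹ * a k)
        + (a (k + 2) + a k - (z + z⁻¹) * a (k + 1)) := by
      field_simp
      ring
    have h : ‖a (k + 1 + 1) - z⁻¹ * a (k + 1)‖ ≤ ‖a (k + 1) - z⁻¹ * a k‖
        + ‖a (k + 2) + a k - (z + z⁻¹) * a (k + 1)‖ := by
      rw [e]
      refine (norm_add_le _ _).trans (add_le_add_left ?_ _)
      rw [norm_mul]
      exact mul_le_of_le_one_left (norm_nonneg _) hz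
    linarith

open Finset in
/-- A null sequence vanishing at `0` is controlled by the sum of its free second order differences,
with a constant that degenerates at `z = ± 1`. -/
theorem norm_sub_inv_mul_norm_le {a : ℕ → ℂ} (ha0 : a 0 = 0) (ha : Tendsto a atTop (𝓝 0)) {z : ℂ}
    (hz0 : z ≠ 0) (hz : ‖z‖ ≤ 1) {S : ℝ}
    (hS : ∀ N, ∑ i ∈ range N, ‖a (i + 2) + a i - (z + z⁻¹) * a (i + 1)‖ ≤ S) (k : ℕ) :
    ‖z - z⁻¹‖ * ‖a k‖ ≤ 2 * S := by
  have hb : Tendsto (fun N => ‖a (N + 1) - z * a N‖) atTop (𝓝 0) := by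
    simpa using (((tendsto_add_atTop_iff_nat 1).2 ha).sub (ha.const_mul z)).norm
  have hlim : Tendsto (fun N => 2 * ‖a (N + 1) - z * a N‖ + 2 * S) atTop (𝓝 (2 * S)) := by
    simpa using (hb.const_mul 2).add_const (2 * S)
  refine ge_of_tendsto hlim ?_
  filter_upwards [eventually_ge_atTop k] with N hN
  have h0 := norm_sub_mul_le_add_sum (a := a) hz0 hz (Nat.zero_le N)
  have hk := norm_sub_mul_le_add_sum (a := a) hz0 hz hN
  have hc := norm_sub_inv_mul_le_add_sum ha0 hz0 hz k
  have hsum := sum_range_add_sum_Ico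
    (fun i => ‖a (i + 2) + a i - (z + z⁻¹) * a (i + 1)‖) hN
  have e : (z - z⁻¹) * a k = (a (k + 1) - z⁻¹ * a k) - (a (k + 1) - z * a k) := by ring
  have h := norm_sub_le (a (k + 1) - z⁻¹ * a k) (a (k + 1) - z * a k)
  rw [← e, norm_mul] at h
  rw [ha0, mul_zero, sub_zero, zero_add, ← range_eq_Ico] at h0
  have := hS N
  linarith

open Finset in
/-- A null sequence vanishing at `0` is controlled by the weighted sum of its free second order
differences, uniformly on the closed unit disk. -/
theorem norm_le_of_weighted_sum_le {a : ℕ → ℂ} (ha0 : a 0 = 0) (ha : Tendsto a atTop (𝓝 0)) {z : ℂ}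
    (hz0 : z ≠ 0) (hz : ‖z‖ ≤ 1) {S : ℝ}
    (hS : ∀ N, ∑ i ∈ range N,
      ((i : ℝ) + 1) * ‖a (i + 2) + a i - (z + z⁻¹) * a (i + 1)‖ ≤ S) (k : ℕ) :
    ‖a k‖ ≤ S := by
  have key : ∀ k : ℕ, ‖a k‖ ≤ k * ‖a (k + 1) - z * a k‖ + ∑ i ∈ range k,
      ((i : ℝ) + 1) * ‖a (i + 2) + a i - (z + z⁻¹) * a (i + 1)‖ := by
    intro k
    induction k with
    | zero => simp [ha0]
    | succ k ih =>
      rw [sum_range_succ]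
      have h1 : ‖a (k + 1)‖ ≤ ‖a k‖ + ‖a (k + 1) - z * a k‖ := by
        have h := norm_add_le (z * a k) (a (k + 1) - z * a k)
        rw [add_sub_cancel, norm_mul] at h
        exact h.trans (add_le_add_left (mul_le_of_le_one_left (norm_nonneg _) hz) _)
      have h2 := norm_sub_mul_le_add_sum (a := a) hz0 hz (Nat.le_succ k)
      rw [Nat.succ_eq_add_one, Nat.Ico_succ_singleton, sum_singleton] at h2
      have h3 := mul_le_mul_of_nonneg_left h2 (show (0 : ℝ) ≤ (k : ℝ) + 1 by positivity)
      push_cast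
      linarith
  have hb : Tendsto (fun N => ‖a (N + 1) - z * a N‖) atTop (𝓝 0) := by
    simpa using (((tendsto_add_atTop_iff_nat 1).2 ha).sub (ha.const_mul z)).norm
  have hlim : Tendsto (fun N => k * ‖a (N + 1) - z * a N‖ + S) atTop (𝓝 S) := by
    simpa using (hb.const_mul (k : ℝ)).add_const S
  refine ge_of_tendsto hlim ?_
  filter_upwards [eventually_ge_atTop k] with N hN
  have h1 := mul_le_mul_of_nonneg_left (norm_sub_mul_le_add_sum (a := a) hz0 hz hN)
    (Nat.cast_nonneg (α := ℝ) k)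
  have h2 : (k : ℝ) * ∑ i ∈ Ico k N, ‖a (i + 2) + a i - (z + z⁻¹) * a (i + 1)‖ ≤
      ∑ i ∈ Ico k N, ((i : ℝ) + 1) * ‖a (i + 2) + a i - (z + z⁻¹) * a (i + 1)‖ := by
    rw [mul_sum]
    refine sum_le_sum fun i hi => mul_le_mul_of_nonneg_right ?_ (norm_nonneg _)
    have : (k : ℝ) ≤ i := by exact_mod_cast (mem_Ico.1 hi).1
    linarith
  have hsum := sum_range_add_sum_Ico
    (fun i => ((i : ℝ) + 1) * ‖a (i + 2) + a i - (z + z⁻¹) * a (i + 1)‖) hN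
  have := hS N
  have := key k
  linarith

/-! ### Extension by zero, and the Joukowski map -/

/-- The extension by zero of a sequence indexed by the positive integers to all integers. -/
def zeroExt (u : ℕ+ → ℂ) (k : ℤ) : ℂ :=
  if h : 0 < k then u ⟨k.toNat, by omega⟩ else 0

theorem zeroExt_coe (u : ℕ+ → ℂ) (n : ℕ+) : zeroExt u (n : ℤ) = u n := by
  unfold zeroExt
  rw [dif_pos (by exact_mod_cast n.pos)]
  congr 1

theorem zeroExt_of_nonpos (u : ℕ+ → ℂ) {k : ℤ} (hk : k ≤ 0) : zeroExt u k = 0 :=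
  dif_neg (not_lt.2 hk)

theorem norm_zeroExt_le {u : ℕ+ → ℂ} {M : ℝ} (hM : ∀ n, ‖u n‖ ≤ M) (k : ℤ) :
    ‖zeroExt u k‖ ≤ M := by
  unfold zeroExt
  split_ifs
  · exact hM _
  · simpa using (norm_nonneg _).trans (hM 1)

/-- Every complex number is `z + z⁻¹` for a nonzero `z` in the closed unit disk. -/
theorem exists_add_inv_eq (w : ℂ) : ∃ z : ℂ, z ≠ 0 ∧ ‖z‖ ≤ 1 ∧ z + z⁻¹ = w := by
  obtain ⟨s, hs⟩ := IsAlgClosed.exists_pow_nat_eq (w ^ 2 - 4) two_pos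
  have hmul : (w + s) / 2 * ((w - s) / 2) = 1 := by linear_combination -hs / 4
  have h0 : (w + s) / 2 ≠ 0 := left_ne_zero_of_mul_eq_one hmul
  have hinv : ((w + s) / 2)⁻¹ = (w - s) / 2 := inv_eq_of_mul_eq_one_right hmul
  have hw : (w + s) / 2 + ((w + s) / 2)⁻¹ = w := by rw [hinv]; ring
  rcases le_total ‖(w + s) / 2‖ 1 with h | h
  · exact ⟨_, h0, h, hw⟩
  · refine ⟨((w + s) / 2)⁻¹, inv_ne_zero h0, ?_, by rw [inv_inv, add_comm, hw]⟩
    rw [norm_inv]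
    exact inv_le_one_of_one_le₀ h

/-! ### Eigenvectors of banded matrices -/

namespace BandedMatrix

variable {p : ℕ} (D : BandedMatrix p)

theorem q_nonneg (n : ℕ+) : 0 ≤ D.q n := by
  unfold q
  positivity

theorem mulSeq_eq_sum_Icc (u : ℕ+ → ℂ) (n : ℕ+) :
    D.mulSeq u n = ∑ r ∈ Finset.Icc (-(p : ℤ)) p,
      extEntry p D.entry n ((n : ℤ) + r) * zeroExt u ((n : ℤ) + r) := by
  rw [mulSeq_eq_sum]
  refine Finset.sum_of_injOn (fun m : ℕ+ => (m : ℤ) - (n : ℤ)) ?_ ?_ ?_ ?_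
  · intro a _ b _ hab
    have hab' : (a : ℤ) - (n : ℤ) = (b : ℤ) - (n : ℤ) := hab
    exact PNat.eq (by omega)
  · intro m hm
    exact Finset.mem_coe.2 (Finset.mem_Icc.2 (abs_le.1 (mem_band.1 hm)))
  · intro r hr hr'
    rw [zeroExt_of_nonpos, mul_zero]
    by_contra! hpos
    obtain ⟨m, hm⟩ : ∃ m : ℕ+, (m : ℤ) = (n : ℤ) + r :=
      ⟨⟨((n : ℤ) + r).toNat, by omega⟩, Int.toNat_of_nonneg hpos.le⟩
    rw [Finset.mem_Icc] at hr
    exact hr' ⟨m, Finset.mem_coe.2 (mem_band.2 (abs_le.2 (by omega))), by simp only [hm]; ring⟩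
  · intro m _
    rw [add_sub_cancel, extEntry_coe, zeroExt_coe]

/-- An eigenvector satisfies the free equation up to an error controlled by `q_n`. -/
theorem norm_secondDiff_le (hp : 1 ≤ p) {u : ℕ+ → ℂ} {w : ℂ} (n : ℕ+)
    (hu : D.mulSeq u n = w * u n) {M : ℝ} (hM : ∀ n, ‖u n‖ ≤ M) :
    ‖zeroExt u ((n : ℤ) + p) + zeroExt u ((n : ℤ) - p) - w * zeroExt u n‖ ≤ D.q n * M := by
  have hIcc : Finset.Icc (-(p : ℤ)) p
      = insert (-(p : ℤ)) (insert (p : ℤ) (Finset.Ioo (-(p : ℤ)) p)) := by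
    ext r
    simp only [Finset.mem_Icc, Finset.mem_insert, Finset.mem_Ioo]
    omega
  rw [mulSeq_eq_sum_Icc, hIcc, Finset.sum_insert (by simp; omega),
    Finset.sum_insert (by simp), ← sub_eq_add_neg] at hu
  have e : zeroExt u ((n : ℤ) + p) + zeroExt u ((n : ℤ) - p) - w * zeroExt u n
      = -((extEntry p D.entry n ((n : ℤ) - p) - 1) * zeroExt u ((n : ℤ) - p)
        + ∑ r ∈ Finset.Ioo (-(p : ℤ)) p,
          extEntry p D.entry n ((n : ℤ) + r) * zeroExt u ((n : ℤ) + r)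
        + (extEntry p D.entry n ((n : ℤ) + p) - 1) * zeroExt u ((n : ℤ) + p)) := by
    rw [zeroExt_coe]
    linear_combination hu
  have hmul : ∀ (c : ℂ) (k : ℤ), ‖c * zeroExt u k‖ ≤ ‖c‖ * M := fun c k => by
    rw [norm_mul]
    exact mul_le_mul_of_nonneg_left (norm_zeroExt_le hM k) (norm_nonneg _)
  rw [e, norm_neg, q, add_mul, add_mul, Finset.sum_mul]
  exact norm_add_le_of_le (norm_add_le_of_le (hmul _ _) (norm_sum_le_of_le _ fun r _ => hmul _ _))
    (hmul _ _)

/-- The two a priori estimates for an eigenvector: every position belongs to a residue class modulo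
`p`, along which the scalar recurrence estimates apply. -/
theorem eigenvector_bounds (hp : 1 ≤ p) {u : EllTwo} {z : ℂ} (hz0 : z ≠ 0) (hz : ‖z‖ ≤ 1)
    (hu : ∀ n, D.mulSeq u n = (z + z⁻¹) * u n) {M : ℝ} (hM : ∀ n, ‖u n‖ ≤ M) (n : ℕ+) :
    (Summable D.q → ‖z - z⁻¹‖ * ‖u n‖ ≤ 2 * (D.Q₀ * M)) ∧
      ((Summable fun n : ℕ+ => (n : ℝ) * D.q n) → ‖u n‖ ≤ D.Q₁ * M) := by
  have hM0 : 0 ≤ M := (norm_nonneg _).trans (hM 1)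
  -- `n = ν k`, where `ν` lists the residue class of `n` modulo `p`
  obtain ⟨ν, k, hk, hν, hν0⟩ : ∃ (ν : ℕ → ℕ+) (k : ℕ), ν k = n ∧
      (∀ i, (ν (i + 1) : ℤ) = (ν i : ℤ) + p) ∧ (ν 0 : ℤ) ≤ p := by
    have hn := n.pos
    refine ⟨fun i => ⟨((n : ℕ) - 1) % p + 1 + p * i, by omega⟩, ((n : ℕ) - 1) / p, ?_, ?_, ?_⟩
    · refine PNat.eq ?_
      have := Nat.mod_add_div ((n : ℕ) - 1) p
      simp only [PNat.mk_coe]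
      omega
    · intro i
      simp only [PNat.mk_coe]
      push_cast
      ring
    · have := Nat.mod_lt ((n : ℕ) - 1) hp
      simp only [PNat.mk_coe]
      omega
  have hmono : StrictMono ν := strictMono_nat_of_lt_succ fun i => by
    have := hν i
    exact PNat.coe_lt_coe _ _ |>.1 (by omega)
  have hle : ∀ i : ℕ, (i : ℝ) + 1 ≤ (ν i : ℕ) := by
    intro i
    suffices i + 1 ≤ (ν i : ℕ) by exact_mod_cast this
    induction i with
    | zero => exact (ν 0).pos
    | succ i ih =>
      have := hν i
      omega
  -- the index is shifted by one so that the sequence starts with the value `0` at `ν 0 - p ≤ 0`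
  set a : ℕ → ℂ := fun j => zeroExt u ((ν j : ℤ) - p) with ha
  have ha_succ : ∀ i, a (i + 1) = u (ν i) := fun i => by
    simp only [ha]
    rw [hν, add_sub_cancel_right, zeroExt_coe]
  have ha0 : a 0 = 0 := zeroExt_of_nonpos _ (by omega)
  have hlim : Tendsto a atTop (𝓝 0) := by
    rw [← tendsto_add_atTop_iff_nat 1]
    simp only [ha_succ]
    have hs : Summable fun m => ‖u m‖ ^ 2 := by
      simpa using (lp.memℓp u).summable (by norm_num)
    have h := (hs.comp_injective hmono.injective).tendsto_atTop_zero.sqrt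
    rw [tendsto_zero_iff_norm_tendsto_zero]
    simpa [Function.comp_def] using h
  have hf : ∀ i, ‖a (i + 2) + a i - (z + z⁻¹) * a (i + 1)‖ ≤ D.q (ν i) * M := by
    intro i
    have h := D.norm_secondDiff_le hp (ν i) (hu _) hM
    rwa [← hν, zeroExt_coe, zeroExt_coe, ← ha_succ, ← ha_succ] at h
  rw [← hk, ← ha_succ]
  constructor
  · intro hs
    refine norm_sub_inv_mul_norm_le ha0 hlim hz0 hz (fun N => ?_) _
    refine (Finset.sum_le_sum fun i _ => hf i).trans ?_
    rw [← Finset.sum_mul]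
    have h := hs.sum_le_tsum ((Finset.range N).map ⟨ν, hmono.injective⟩) fun i _ => D.q_nonneg i
    rw [Finset.sum_map] at h
    exact mul_le_mul_of_nonneg_right h hM0
  · intro hs
    refine norm_le_of_weighted_sum_le ha0 hlim hz0 hz (fun N => ?_) _
    refine (Finset.sum_le_sum fun i _ => (mul_le_mul (hle i) (hf i) (norm_nonneg _)
      (Nat.cast_nonneg _)).trans_eq (mul_assoc _ _ _).symm).trans ?_
    rw [← Finset.sum_mul]
    have h := hs.sum_le_tsum ((Finset.range N).map ⟨ν, hmono.injective⟩) fun i _ =>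
      mul_nonneg (Nat.cast_nonneg _) (D.q_nonneg i)
    rw [Finset.sum_map] at h
    exact mul_le_mul_of_nonneg_right h hM0

/-- An eigenvalue `z + z⁻¹` of `D` with `0 < ‖z‖ ≤ 1` satisfies `‖z - z⁻¹‖ ≤ 2 Q₀` and `1 ≤ Q₁`,
as soon as these sums converge. -/
theorem bounds_of_hasEigenvalue (hp : 1 ≤ p) {z : ℂ} (hz0 : z ≠ 0) (hz : ‖z‖ ≤ 1)
    (h : Module.End.HasEigenvalue (D.toOperator : EllTwo →ₗ[ℂ] EllTwo) (z + z⁻¹)) :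
    (Summable D.q → ‖z - z⁻¹‖ ≤ 2 * D.Q₀) ∧
      ((Summable fun n : ℕ+ => (n : ℝ) * D.q n) → 1 ≤ D.Q₁) := by
  obtain ⟨u, hu⟩ := h.exists_hasEigenvector
  have hmul : ∀ n, D.mulSeq u n = (z + z⁻¹) * u n := fun n =>
    congrArg (fun v : EllTwo => v n) hu.apply_eq_smul
  have hbdd : BddAbove (Set.range fun n => ‖u n‖) :=
    ⟨‖u‖, by rintro _ ⟨n, rfl⟩; exact lp.norm_apply_le_norm (by norm_num) u n⟩
  have hM : ∀ n, ‖u n‖ ≤ ⨆ n, ‖u n‖ := le_ciSup hbdd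
  obtain ⟨n, hn⟩ : ∃ n, u n ≠ 0 := by
    by_contra! h0
    exact hu.2 (lp.ext (funext h0))
  have hpos : 0 < ⨆ n, ‖u n‖ := (norm_pos_iff.2 hn).trans_le (hM n)
  have key := D.eigenvector_bounds hp hz0 hz hmul hM
  constructor
  · intro hs
    refine le_of_mul_le_mul_right ?_ hpos
    rw [Real.mul_iSup_of_nonneg (norm_nonneg _), mul_assoc]
    exact ciSup_le fun n => (key n).1 hs
  · intro hs
    refine le_of_mul_le_mul_right ?_ hpos
    rw [one_mul]
    exact ciSup_le fun n => (key n).2 hs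

end BandedMatrix

/-! ### Location of the discrete spectrum -/

theorem mainTheorem5 (p : ℕ) (hp : 1 ≤ p) (D : BandedMatrix p)
    (hQ₀ : Summable D.q) (hq : D.qSup < 1)
    (t : ℝ) (ht : t * Real.exp t = 1) :
    Disjoint
      ((fun z : ℂ => z + z⁻¹) ''
        {z : ℂ | ‖z‖ < 1 ∧ z ≠ 0 ∧
          8 * D.Q₀ / t * Real.exp ((2 - D.qSup) / (1 - D.qSup) * D.Q₀) < ‖z - z⁻¹‖})
      (discreteSpectrum D.toOperator) ∧
    ((Summable fun n : ℕ+ => (n : ℝ) * D.q n) →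
      Real.exp ((2 - D.qSup) / (1 - D.qSup) * D.Q₀) * D.Q₁ < t / 4 →
      discreteSpectrum D.toOperator = ∅) := by
  have ht0 : 0 < t := pos_of_mul_pos_left (ht ▸ one_pos) (Real.exp_pos t).le
  have ht1 : t ≤ 1 := by
    rw [← ht]
    exact le_mul_of_one_le_right ht0.le (Real.one_le_exp ht0.le)
  have hQ0 : 0 ≤ D.Q₀ := tsum_nonneg D.q_nonneg
  have hexp : 1 ≤ Real.exp ((2 - D.qSup) / (1 - D.qSup) * D.Q₀) :=
    Real.one_le_exp (mul_nonneg (div_nonneg (by linarith) (by linarith)) hQ0)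
  refine ⟨Set.disjoint_left.2 ?_, fun hQ₁ hlt => Set.eq_empty_iff_forall_notMem.2 fun w hw => ?_⟩
  · rintro _ ⟨z, ⟨hz, hz0, hlt⟩, rfl⟩ hmem
    have h1 := (D.bounds_of_hasEigenvalue hp hz0 hz.le hmem.2.1).1 hQ₀
    have h2 : 8 * D.Q₀ ≤ 8 * D.Q₀ / t := le_div_self (by positivity) ht0 ht1
    have h3 : 8 * D.Q₀ / t ≤ 8 * D.Q₀ / t * Real.exp ((2 - D.qSup) / (1 - D.qSup) * D.Q₀) :=
      le_mul_of_one_le_right (by positivity) hexp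
    linarith
  · obtain ⟨z, hz0, hz, rfl⟩ := exists_add_inv_eq w
    have h1 := (D.bounds_of_hasEigenvalue hp hz0 hz hw.2.1).2 hQ₁
    have h2 := one_le_mul_of_one_le_of_one_le hexp h1
    linarith
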